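/- Let $a>b$ be real numbers and let $k$ be real with $0<k^2<1$. All Jacobi elliptic functions $\mathrm{sn},\mathrm{cn},\mathrm{dn}$ have modulus $k$ and real argument. Consider the confocal family $\frac{x^2}{a+\lambda}+\frac{y^2}{b+\lambda}=1$. (1) Continuous case. For $s_1,s_2\in\mathbb R$ with $\mathrm{sn}(s_2)\neq 0$ put $$x=\frac{f_1(s_1)f_2(s_2)}{\sqrt{a-b}},\qquad y=\frac{g_1(s_1)g_2(s_2)}{\sqrt{a-b}},$$ $$f_1=k\sqrt{a-b}\,\mathrm{sn},\quad g_1=\sqrt{a-b}\,\mathrm{dn},\quad f_2=\sqrt{a-b}\,\frac1{\mathrm{sn}},\quad g_2=\sqrt{a-b}\,\frac{\mathrm{cn}}{\mathrm{sn}}.$$ Let $a_0=k^2(a-b)$ and $c_0=(1-k^2)(a-b)$, and let $\mathcal H_0$ be the curve $\frac{x^2}{a_0}-\frac{y^2}{c_0}=1$. Then for every $\xi\in\mathbb R$ all points $(x,y)$ with $s_1+s_2=\xi$ lie on a straight line, and for every $\eta\in\mathbb R$ all points $(x,y)$ with $s_2-s_1=\eta$ lie on a straight line. The line is tangent to $\mathcal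 H_0$ at a point of $\mathcal H_0$ if $\mathrm{cn}(\xi)\ne0$ (respectively $\mathrm{cn}(\eta)\neq 0$), and it is an asymptote of $\mathcal H_0$, i.e. tangent to $\mathcal H_0$ at infinity, if $\mathrm{cn}(\xi)=0$ (respectively $\mathrm{cn}(\eta)=0$). Moreover $a_0,c_0>0$, $a_0+c_0=a-b$, and the hyperbola $\mathcal H_0$ belongs to the confocal family, for some $\lambda\in(-a,-b)$. (2) Discrete case. Let $\delta,c_1,c_2\in\mathbb R$ with $\mathrm{cn}(\delta/2)>0$. For $n_1,n_2\in\frac12\mathbb Z$ with $\mathrm{sn}(\delta n_2+c_2)\ne0$ put $$x=\frac{f_1(n_1)f_2(n_2)}{\sqrt{a-b}},\qquad y=\frac{g_1(n_1)g_2(n_2)}{\sqrt{a-b}},$$ $$f_1(n_1)=k\hat\alpha\,\mathrm{sn}(\delta n_1+c_1),\quad g_1(n_1)=\hat\beta\,\mathrm{dn}(\delta n_1+c_1),\quad f_2(n_2)=\frac{\hat\alpha}{\mathrm{sn}(\delta n_2+c_2)},\quad g_2(n_2)=\hat\beta\,\frac{\mathrm{cn}(\delta n_2+c_2)}{\mathrm{sn}(\delta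 n_2+c_2)},$$ $$\hat\alpha=\sqrt{(a-b)\frac{\mathrm{cn}(\delta/2)}{\mathrm{dn}(\delta/2)}},\qquad \hat\beta=\sqrt{\frac{a-b}{\mathrm{dn}(\delta/2)}}.$$ Let $$\hat a_0=(a-b)k^2\frac{\mathrm{cn}^2(\delta/2)}{\mathrm{dn}^2(\delta/2)},\qquad \hat c_0=(a-b)(1-k^2)\frac1{\mathrm{dn}^2(\delta/2)},$$ and let $\hat{\mathcal H}_0$ be the curve $\frac{x^2}{\hat a_0}-\frac{y^2}{\hat c_0}=1$. Then for every $\xi\in\frac12\mathbb Z$ all points $(x,y)$ with $n_1+n_2=\xi$ lie on a straight line which is tangent to $\hat{\mathcal H}_0$ at a point of $\hat{\mathcal H}_0$ if $\mathrm{cn}(\delta\xi+c_1+c_2)\neq0$, and which is an asymptote of $\hat{\mathcal H}_0$ if $\mathrm{cn}(\delta\xi+c_1+c_2)=0$. Likewise, for every $\eta\in\frac12\mathbb Z$ all points $(x,y)$ with $n_2-n_1=\eta$ lie on a straight line which is tangent to $\hat{\mathcal H}_0$ at a point of $\hat{\mathcal H}_0$ if $\mathrm{cn}(\delta\eta+c_2-c_1)\neq0$,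 and which is an asymptote of $\hat{\mathcal H}_0$ if $\mathrm{cn}(\delta\eta+c_2-c_1)=0$. Moreover $\hat a_0,\hat c_0>0$, $\hat a_0+\hat c_0=a-b$, and the hyperbola $\hat{\mathcal H}_0$ belongs to the confocal family, for some $\lambda\in(-a,-b)$. -/

import Mathlib

/-! ### Jacobi elliptic functions of a real argument -/

/-- The incomplete elliptic integral of the first kind with modulus `k`. -/
noncomputable def ellipticF (k φ : ℝ) : ℝ :=
  ∫ θ in (0 : ℝ)..φ, 1 / Real.sqrt (1 - k ^ 2 * Real.sin θ ^ 2)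

theorem ellipticF_integrand_continuous {k : ℝ} (hk : k ^ 2 < 1) :
    Continuous fun θ : ℝ => 1 / Real.sqrt (1 - k ^ 2 * Real.sin θ ^ 2) := by
  have h : ∀ θ : ℝ, 0 < 1 - k ^ 2 * Real.sin θ ^ 2 := fun θ => by
    nlinarith [Real.sin_sq_le_one θ, sq_nonneg k, sq_nonneg (Real.sin θ)]
  refine continuous_const.div (by fun_prop) fun θ => (Real.sqrt_pos.2 (h θ)).ne'

theorem ellipticF_hasDerivAt {k : ℝ} (hk : k ^ 2 < 1) (φ : ℝ) :
    HasDerivAt (ellipticF k) (1 / Real.sqrt (1 - k ^ 2 * Real.sin φ ^ 2)) φ :=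
  (ellipticF_integrand_continuous hk).integral_hasStrictDerivAt 0 φ |>.hasDerivAt

theorem one_le_ellipticF_integrand {k : ℝ} (hk : k ^ 2 < 1) (θ : ℝ) :
    1 ≤ 1 / Real.sqrt (1 - k ^ 2 * Real.sin θ ^ 2) := by
  have h : 0 < 1 - k ^ 2 * Real.sin θ ^ 2 := by
    nlinarith [Real.sin_sq_le_one θ, sq_nonneg k, sq_nonneg (Real.sin θ)]
  rw [le_div_iff₀ (Real.sqrt_pos.2 h), one_mul, Real.sqrt_le_iff]
  refine ⟨zero_le_one, ?_⟩
  nlinarith [mul_nonneg (sq_nonneg k) (sq_nonneg (Real.sin θ))]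

/-- For `k² < 1` the elliptic integral is a bijection of the real line, so that its inverse, the
amplitude, is well defined. -/
theorem ellipticF_bijective {k : ℝ} (hk : k ^ 2 < 1) : Function.Bijective (ellipticF k) := by
  have hd := ellipticF_hasDerivAt hk
  have hmono : Monotone fun φ => ellipticF k φ - φ := by
    refine monotone_of_hasDerivAt_nonneg (f' := fun φ =>
      1 / Real.sqrt (1 - k ^ 2 * Real.sin φ ^ 2) - 1)
      (fun φ => (hd φ).sub (hasDerivAt_id φ)) fun φ => ?_
    exact sub_nonneg.2 (one_le_ellipticF_integrand hk φ)
  have h0 : ellipticF k 0 = 0 := by simp [ellipticF]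
  constructor
  · intro x y hxy
    rcases le_total x y with h | h
    · have := hmono h
      simp only at this
      linarith
    · have := hmono h
      simp only at this
      linarith
  · have hc : Continuous (ellipticF k) :=
      continuous_iff_continuousAt.2 fun φ => (hd φ).continuousAt
    refine hc.surjective ?_ ?_
    · refine Filter.tendsto_atTop_mono' _ ?_ Filter.tendsto_id
      filter_upwards [Filter.eventually_ge_atTop 0] with x hx
      have := hmono hx
      simp only [h0] at this
      simp only [id]
      linarith
    · refine Filter.tendsto_atBot_mono' _ ?_ Filter.tendsto_id
      filter_upwards [Filter.eventually_le_atBot 0] with x hx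
      have := hmono hx
      simp only [h0] at this
      simp only [id]
      linarith

/-- The Jacobi amplitude `am(u, k)`: the inverse of the elliptic integral of the first kind. -/
noncomputable def jacobiAm (k u : ℝ) : ℝ := Function.invFun (ellipticF k) u

/-- `sn(u, k)` -/
noncomputable def jacobiSn (k u : ℝ) : ℝ := Real.sin (jacobiAm k u)

/-- `cn(u, k)` -/
noncomputable def jacobiCn (k u : ℝ) : ℝ := Real.cos (jacobiAm k u)

/-- `dn(u, k)` -/
noncomputable def jacobiDn (k u : ℝ) : ℝ := Real.sqrt (1 - k ^ 2 * jacobiSn k u ^ 2)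

/-! ### Conics, tangent lines and asymptotes in the plane -/

/-- The conic `x² / (a + l) + y² / (b + l) = 1` of the confocal family with parameters `a`, `b`. -/
def confocalConic (a b l : ℝ) : Set (ℝ × ℝ) :=
  {p | p.1 ^ 2 / (a + l) + p.2 ^ 2 / (b + l) = 1}

/-- The quadratic form `x² / a₀ - y² / c₀`. -/
noncomputable def hyperbolaForm (a₀ c₀ : ℝ) (p : ℝ × ℝ) : ℝ := p.1 ^ 2 / a₀ - p.2 ^ 2 / c₀

/-- The hyperbola `x² / a₀ - y² / c₀ = 1`. -/
def hyperbola (a₀ c₀ : ℝ) : Set (ℝ × ℝ) := {p | hyperbolaForm a₀ c₀ p = 1}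

/-- A straight line in the plane. -/
def IsStraightLine (L : AffineSubspace ℝ (ℝ × ℝ)) : Prop :=
  Module.finrank ℝ L.direction = 1

/-- `L` is the tangent line of the hyperbola `x² / a₀ - y² / c₀ = 1` at one of its points `p`:
it is a line through `p`, and the differential of the defining function at `p` vanishes along it. -/
def IsTangentLine (a₀ c₀ : ℝ) (L : AffineSubspace ℝ (ℝ × ℝ)) : Prop :=
  IsStraightLine L ∧ ∃ p ∈ hyperbola a₀ c₀, p ∈ L ∧
    ∀ v ∈ L.direction, fderiv ℝ (hyperbolaForm a₀ c₀) p v = 0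

/-- `L` is one of the two asymptotes `y = ± √(c₀ / a₀) x` of the hyperbola
`x² / a₀ - y² / c₀ = 1`, that is, one of its two tangents at infinity. -/
def IsAsymptote (a₀ c₀ : ℝ) (L : AffineSubspace ℝ (ℝ × ℝ)) : Prop :=
  (L : Set (ℝ × ℝ)) = {q | q.2 = Real.sqrt (c₀ / a₀) * q.1} ∨
    (L : Set (ℝ × ℝ)) = {q | q.2 = -Real.sqrt (c₀ / a₀) * q.1}

/-! ### The two parametrizations -/

/-- The point `(f₁(t₁) f₂(t₂) / √(a - b), g₁(t₁) g₂(t₂) / √(a - b))`. -/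
noncomputable def confocalPoint (a b : ℝ) (f₁ g₁ f₂ g₂ : ℝ → ℝ) (t₁ t₂ : ℝ) : ℝ × ℝ :=
  (f₁ t₁ * f₂ t₂ / Real.sqrt (a - b), g₁ t₁ * g₂ t₂ / Real.sqrt (a - b))

/-- The continuous coordinate system; the point is meaningful where `sn(s₂, k) ≠ 0`. -/
noncomputable def continuousPoint (a b k : ℝ) : ℝ → ℝ → ℝ × ℝ :=
  confocalPoint a b
    (fun s => k * Real.sqrt (a - b) * jacobiSn k s)
    (fun s => Real.sqrt (a - b) * jacobiDn k s)
    (fun s => Real.sqrt (a - b) * (1 / jacobiSn k s))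
    (fun s => Real.sqrt (a - b) * (jacobiCn k s / jacobiSn k s))

/-- The amplitude `α̂₂ = α̂₁ / k` of the discrete system. -/
noncomputable def alphaHat (a b k δ : ℝ) : ℝ :=
  Real.sqrt ((a - b) * (jacobiCn k (δ / 2) / jacobiDn k (δ / 2)))

/-- The amplitude `β̂₁ = β̂₂` of the discrete system. -/
noncomputable def betaHat (a b k δ : ℝ) : ℝ :=
  Real.sqrt ((a - b) / jacobiDn k (δ / 2))

/-- The discrete coordinate system; the point is meaningful where `sn(δ n₂ + c₂, k) ≠ 0`. -/
noncomputable def discretePoint (a b k δ c₁ c₂ : ℝ) : ℝ → ℝ → ℝ × ℝ :=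
  confocalPoint a b
    (fun n => k * alphaHat a b k δ * jacobiSn k (δ * n + c₁))
    (fun n => betaHat a b k δ * jacobiDn k (δ * n + c₁))
    (fun n => alphaHat a b k δ * (1 / jacobiSn k (δ * n + c₂)))
    (fun n => betaHat a b k δ * (jacobiCn k (δ * n + c₂) / jacobiSn k (δ * n + c₂)))

/-- The lattice `½ ℤ` inside the real line. -/
def halfIntegers : Set ℝ := Set.range fun m : ℤ => (m : ℝ) / 2

/-- `â₀ = (a - b) k² cn²(δ/2, k) / dn²(δ/2, k)` -/
noncomputable def aHat (a b k δ : ℝ) : ℝ :=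
  (a - b) * k ^ 2 * (jacobiCn k (δ / 2) ^ 2 / jacobiDn k (δ / 2) ^ 2)

/-- `ĉ₀ = (a - b) (1 - k²) / dn²(δ/2, k)` -/
noncomputable def cHat (a b k δ : ℝ) : ℝ :=
  (a - b) * (1 - k ^ 2) * (1 / jacobiDn k (δ / 2) ^ 2)

/-! ### Derivatives of the Jacobi elliptic functions -/

/-! Everything rests on one identity, `jacobi_linear_relation`: with `w = u + v` fixed, `sn w · dn u
· cn v = dn w · sn u + cn w · sn v`. Divided by `sn v`, it is a linear equation between `sn u / sn
v` and `dn u · cn v / sn v`, which are the coordinates up to constant factors, so the points with `u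
+ v = w` lie on a line. A line `A x + B y = C` touches `x²/a₀ - y²/c₀ = 1`, possibly at infinity,
when `a₀ A² - c₀ B² = C²`; here this reads `dn² w - (1 - k²) sn² w = cn² w`, and `C` vanishes
exactly with `cn w`.

The lines `v - u = η` follow by the symmetry `(k, u) ↦ (-k, -u)`, and the discrete system is the
continuous one with its axes rescaled by `P` and `Q` (`scaledPoint`). The linear relation itself
comes from the addition theorems, proved by differentiating along `u + v = ξ`. -/

theorem ellipticF_jacobiAm {k : ℝ} (hk : k ^ 2 < 1) (u : ℝ) : ellipticF k (jacobiAm k u) = u :=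
  Function.rightInverse_invFun (ellipticF_bijective hk).2 u

theorem jacobiAm_ellipticF {k : ℝ} (hk : k ^ 2 < 1) (φ : ℝ) : jacobiAm k (ellipticF k φ) = φ :=
  Function.leftInverse_invFun (ellipticF_bijective hk).1 φ

theorem jacobiAm_zero {k : ℝ} (hk : k ^ 2 < 1) : jacobiAm k 0 = 0 := by
  simpa [ellipticF] using jacobiAm_ellipticF hk 0

theorem ellipticF_neg (k φ : ℝ) : ellipticF k (-φ) = -ellipticF k φ := by
  have h := intervalIntegral.integral_comp_neg
    (fun θ : ℝ => 1 / Real.sqrt (1 - k ^ 2 * Real.sin θ ^ 2)) (a := 0) (b := φ)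
  simp only [Real.sin_neg, neg_sq, neg_zero] at h
  rw [ellipticF, ellipticF, h, intervalIntegral.integral_symm]

theorem jacobiAm_neg {k : ℝ} (hk : k ^ 2 < 1) (u : ℝ) : jacobiAm k (-u) = -jacobiAm k u := by
  apply (ellipticF_bijective hk).1
  rw [ellipticF_neg, ellipticF_jacobiAm hk, ellipticF_jacobiAm hk]

theorem ellipticF_strictMono {k : ℝ} (hk : k ^ 2 < 1) : StrictMono (ellipticF k) :=
  strictMono_of_hasDerivAt_pos (ellipticF_hasDerivAt hk) fun φ =>
    zero_lt_one.trans_le (one_le_ellipticF_integrand hk φ)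

/-- A monotone surjection of the line has no jumps. Continuity is what the inverse function rule for
`jacobiAm` requires. -/
theorem jacobiAm_continuous {k : ℝ} (hk : k ^ 2 < 1) : Continuous (jacobiAm k) := by
  refine Monotone.continuous_of_surjective (fun u v huv => ?_)
    fun φ => ⟨ellipticF k φ, jacobiAm_ellipticF hk φ⟩
  rw [← (ellipticF_strictMono hk).le_iff_le, ellipticF_jacobiAm hk, ellipticF_jacobiAm hk]
  exact huv

theorem jacobiSn_sq_add_jacobiCn_sq (k u : ℝ) : jacobiSn k u ^ 2 + jacobiCn k u ^ 2 = 1 :=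
  Real.sin_sq_add_cos_sq _

theorem one_sub_sq_mul_jacobiSn_sq_pos {k : ℝ} (hk : k ^ 2 < 1) (u : ℝ) :
    0 < 1 - k ^ 2 * jacobiSn k u ^ 2 := by
  nlinarith [jacobiSn_sq_add_jacobiCn_sq k u, sq_nonneg k, sq_nonneg (jacobiSn k u),
    sq_nonneg (jacobiCn k u)]

theorem jacobiDn_pos {k : ℝ} (hk : k ^ 2 < 1) (u : ℝ) : 0 < jacobiDn k u :=
  Real.sqrt_pos.2 (one_sub_sq_mul_jacobiSn_sq_pos hk u)

theorem jacobiDn_sq {k : ℝ} (hk : k ^ 2 < 1) (u : ℝ) :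
    jacobiDn k u ^ 2 = 1 - k ^ 2 * jacobiSn k u ^ 2 :=
  Real.sq_sqrt (one_sub_sq_mul_jacobiSn_sq_pos hk u).le

theorem jacobiAm_hasDerivAt {k : ℝ} (hk : k ^ 2 < 1) (u : ℝ) :
    HasDerivAt (jacobiAm k) (jacobiDn k u) u := by
  have h := HasDerivAt.of_local_left_inverse (jacobiAm_continuous hk).continuousAt
    (ellipticF_hasDerivAt hk (jacobiAm k u))
    (zero_lt_one.trans_le (one_le_ellipticF_integrand hk _)).ne'
    (Filter.Eventually.of_forall (ellipticF_jacobiAm hk))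
  simpa [jacobiDn, jacobiSn] using h

theorem jacobiSn_hasDerivAt {k : ℝ} (hk : k ^ 2 < 1) (u : ℝ) :
    HasDerivAt (jacobiSn k) (jacobiCn k u * jacobiDn k u) u :=
  (jacobiAm_hasDerivAt hk u).sin

theorem jacobiCn_hasDerivAt {k : ℝ} (hk : k ^ 2 < 1) (u : ℝ) :
    HasDerivAt (jacobiCn k) (-jacobiSn k u * jacobiDn k u) u :=
  (jacobiAm_hasDerivAt hk u).cos

theorem jacobiDn_hasDerivAt {k : ℝ} (hk : k ^ 2 < 1) (u : ℝ) :
    HasDerivAt (jacobiDn k) (-k ^ 2 * jacobiSn k u * jacobiCn k u) u := by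
  have h := ((((jacobiSn_hasDerivAt hk u).pow 2).const_mul (k ^ 2)).const_sub 1).sqrt
    (one_sub_sq_mul_jacobiSn_sq_pos hk u).ne'
  refine h.congr_deriv ?_
  have hd := (jacobiDn_pos hk u).ne'
  -- The square root produced by the chain rule is `dn` by definition.
  change _ / (2 * jacobiDn k u) = _
  field_simp
  norm_num
  ring

theorem jacobiSn_zero {k : ℝ} (hk : k ^ 2 < 1) : jacobiSn k 0 = 0 := by
  simp [jacobiSn, jacobiAm_zero hk]

theorem jacobiCn_zero {k : ℝ} (hk : k ^ 2 < 1) : jacobiCn k 0 = 1 := by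
  simp [jacobiCn, jacobiAm_zero hk]

theorem jacobiDn_zero {k : ℝ} (hk : k ^ 2 < 1) : jacobiDn k 0 = 1 := by
  simp [jacobiDn, jacobiSn_zero hk]

theorem jacobiSn_neg {k : ℝ} (hk : k ^ 2 < 1) (u : ℝ) : jacobiSn k (-u) = -jacobiSn k u := by
  simp [jacobiSn, jacobiAm_neg hk]

theorem jacobiDn_neg {k : ℝ} (hk : k ^ 2 < 1) (u : ℝ) : jacobiDn k (-u) = jacobiDn k u := by
  simp [jacobiDn, jacobiSn_neg hk]

/-! ### Addition theorems -/

theorem jacobi_addition_denom_pos {k : ℝ} (hk : k ^ 2 < 1) (u v : ℝ) :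
    0 < 1 - k ^ 2 * jacobiSn k u ^ 2 * jacobiSn k v ^ 2 := by
  have hu := one_sub_sq_mul_jacobiSn_sq_pos hk u
  have hv : jacobiSn k v ^ 2 ≤ 1 := Real.sin_sq_le_one _
  nlinarith [mul_nonneg (mul_nonneg (sq_nonneg k) (sq_nonneg (jacobiSn k u))) (sub_nonneg.2 hv)]

/-- A function of `u` and `v` whose derivative along every line `u + v = ξ` vanishes depends only
on `u + v`. -/
theorem eq_of_hasDerivAt_zero_on_antidiagonal {G : ℝ → ℝ → ℝ}
    (hG : ∀ ξ t : ℝ, HasDerivAt (fun s => G (ξ - s) s) 0 t) (u v : ℝ) : G u v = G (u + v) 0 := by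
  have h := is_const_of_deriv_eq_zero (fun t => (hG (u + v) t).differentiableAt)
    (fun t => (hG (u + v) t).deriv) v 0
  simpa using h

theorem hasDerivAt_comp_antidiagonal {f : ℝ → ℝ} {f' ξ t : ℝ} (h : HasDerivAt f f' (ξ - t)) :
    HasDerivAt (fun s => f (ξ - s)) (-f') t := by
  simpa using h.comp_const_sub ξ t

theorem jacobiSn_add {k : ℝ} (hk : k ^ 2 < 1) (u v : ℝ) :
    jacobiSn k (u + v) = (jacobiSn k u * jacobiCn k v * jacobiDn k v +
      jacobiSn k v * jacobiCn k u * jacobiDn k u) /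
        (1 - k ^ 2 * jacobiSn k u ^ 2 * jacobiSn k v ^ 2) := by
  have h := eq_of_hasDerivAt_zero_on_antidiagonal (G := fun u v =>
    (jacobiSn k u * jacobiCn k v * jacobiDn k v + jacobiSn k v * jacobiCn k u * jacobiDn k u) /
      (1 - k ^ 2 * jacobiSn k u ^ 2 * jacobiSn k v ^ 2)) (fun ξ t => ?_) u v
  -- At `v = 0` the quotient collapses to `sn (u + v)`; what remains is that its derivative along
  -- the antidiagonal vanishes.
  · simpa [jacobiSn_zero hk, jacobiCn_zero hk, jacobiDn_zero hk] using h.symm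
  have s1 := hasDerivAt_comp_antidiagonal (jacobiSn_hasDerivAt hk (ξ - t))
  have c1 := hasDerivAt_comp_antidiagonal (jacobiCn_hasDerivAt hk (ξ - t))
  have d1 := hasDerivAt_comp_antidiagonal (jacobiDn_hasDerivAt hk (ξ - t))
  have s2 := jacobiSn_hasDerivAt hk t
  have c2 := jacobiCn_hasDerivAt hk t
  have d2 := jacobiDn_hasDerivAt hk t
  have hD := (jacobi_addition_denom_pos hk (ξ - t) t).ne'
  refine ((((s1.mul c2).mul d2).add ((s2.mul c1).mul d1)).div
    ((((s1.pow 2).const_mul (k ^ 2)).mul (s2.pow 2)).const_sub 1) hD).congr_deriv ?_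
  rw [div_eq_zero_iff]
  left
  have e1 := jacobiSn_sq_add_jacobiCn_sq k (ξ - t)
  have e2 := jacobiSn_sq_add_jacobiCn_sq k t
  have e3 := jacobiDn_sq hk (ξ - t)
  have e4 := jacobiDn_sq hk t
  simp only [Pi.mul_apply, Pi.add_apply, Pi.pow_apply]
  -- The numerator of the quotient rule is a polynomial in six values, and vanishes modulo the four
  -- quadratic relations `e1`–`e4`.
  generalize jacobiSn k (ξ - t) = S at *
  generalize jacobiCn k (ξ - t) = C at *
  generalize jacobiDn k (ξ - t) = D at *
  generalize jacobiSn k t = s at *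
  generalize jacobiCn k t = c at *
  generalize jacobiDn k t = d at *
  grind

theorem jacobiCn_add {k : ℝ} (hk : k ^ 2 < 1) (u v : ℝ) :
    jacobiCn k (u + v) = (jacobiCn k u * jacobiCn k v -
      jacobiSn k u * jacobiSn k v * jacobiDn k u * jacobiDn k v) /
        (1 - k ^ 2 * jacobiSn k u ^ 2 * jacobiSn k v ^ 2) := by
  have h := eq_of_hasDerivAt_zero_on_antidiagonal (G := fun u v =>
    (jacobiCn k u * jacobiCn k v - jacobiSn k u * jacobiSn k v * jacobiDn k u * jacobiDn k v) /
      (1 - k ^ 2 * jacobiSn k u ^ 2 * jacobiSn k v ^ 2)) (fun ξ t => ?_) u v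
  · simpa [jacobiSn_zero hk, jacobiCn_zero hk, jacobiDn_zero hk] using h.symm
  have s1 := hasDerivAt_comp_antidiagonal (jacobiSn_hasDerivAt hk (ξ - t))
  have c1 := hasDerivAt_comp_antidiagonal (jacobiCn_hasDerivAt hk (ξ - t))
  have d1 := hasDerivAt_comp_antidiagonal (jacobiDn_hasDerivAt hk (ξ - t))
  have s2 := jacobiSn_hasDerivAt hk t
  have c2 := jacobiCn_hasDerivAt hk t
  have d2 := jacobiDn_hasDerivAt hk t
  have hD := (jacobi_addition_denom_pos hk (ξ - t) t).ne'
  refine (((c1.mul c2).sub (((s1.mul s2).mul d1).mul d2)).div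
    ((((s1.pow 2).const_mul (k ^ 2)).mul (s2.pow 2)).const_sub 1) hD).congr_deriv ?_
  rw [div_eq_zero_iff]
  left
  have e1 := jacobiSn_sq_add_jacobiCn_sq k (ξ - t)
  have e2 := jacobiSn_sq_add_jacobiCn_sq k t
  have e3 := jacobiDn_sq hk (ξ - t)
  have e4 := jacobiDn_sq hk t
  simp only [Pi.mul_apply, Pi.sub_apply, Pi.pow_apply]
  generalize jacobiSn k (ξ - t) = S at *
  generalize jacobiCn k (ξ - t) = C at *
  generalize jacobiDn k (ξ - t) = D at *
  generalize jacobiSn k t = s at *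
  generalize jacobiCn k t = c at *
  generalize jacobiDn k t = d at *
  grind

theorem jacobiDn_add {k : ℝ} (hk : k ^ 2 < 1) (u v : ℝ) :
    jacobiDn k (u + v) = (jacobiDn k u * jacobiDn k v -
      k ^ 2 * jacobiSn k u * jacobiSn k v * jacobiCn k u * jacobiCn k v) /
        (1 - k ^ 2 * jacobiSn k u ^ 2 * jacobiSn k v ^ 2) := by
  have h := eq_of_hasDerivAt_zero_on_antidiagonal (G := fun u v =>
    (jacobiDn k u * jacobiDn k v -
      k ^ 2 * jacobiSn k u * jacobiSn k v * jacobiCn k u * jacobiCn k v) /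
      (1 - k ^ 2 * jacobiSn k u ^ 2 * jacobiSn k v ^ 2)) (fun ξ t => ?_) u v
  · simpa [jacobiSn_zero hk, jacobiCn_zero hk, jacobiDn_zero hk] using h.symm
  have s1 := hasDerivAt_comp_antidiagonal (jacobiSn_hasDerivAt hk (ξ - t))
  have c1 := hasDerivAt_comp_antidiagonal (jacobiCn_hasDerivAt hk (ξ - t))
  have d1 := hasDerivAt_comp_antidiagonal (jacobiDn_hasDerivAt hk (ξ - t))
  have s2 := jacobiSn_hasDerivAt hk t
  have c2 := jacobiCn_hasDerivAt hk t
  have d2 := jacobiDn_hasDerivAt hk t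
  have hD := (jacobi_addition_denom_pos hk (ξ - t) t).ne'
  refine (((d1.mul d2).sub ((((s1.const_mul (k ^ 2)).mul s2).mul c1).mul c2)).div
    ((((s1.pow 2).const_mul (k ^ 2)).mul (s2.pow 2)).const_sub 1) hD).congr_deriv ?_
  rw [div_eq_zero_iff]
  left
  have e1 := jacobiSn_sq_add_jacobiCn_sq k (ξ - t)
  have e2 := jacobiSn_sq_add_jacobiCn_sq k t
  have e3 := jacobiDn_sq hk (ξ - t)
  have e4 := jacobiDn_sq hk t
  simp only [Pi.mul_apply, Pi.sub_apply, Pi.pow_apply]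
  generalize jacobiSn k (ξ - t) = S at *
  generalize jacobiCn k (ξ - t) = C at *
  generalize jacobiDn k (ξ - t) = D at *
  generalize jacobiSn k t = s at *
  generalize jacobiCn k t = c at *
  generalize jacobiDn k t = d at *
  grind

/-- For fixed `u + v`, the products `dn u cn v`, `sn u` and `sn v` are linearly related. -/
theorem jacobi_linear_relation {k : ℝ} (hk : k ^ 2 < 1) (u v : ℝ) :
    jacobiSn k (u + v) * (jacobiDn k u * jacobiCn k v) =
      jacobiDn k (u + v) * jacobiSn k u + jacobiCn k (u + v) * jacobiSn k v := by
  have hD := (jacobi_addition_denom_pos hk u v).ne'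
  have e1 := jacobiSn_sq_add_jacobiCn_sq k u
  have e2 := jacobiSn_sq_add_jacobiCn_sq k v
  have e3 := jacobiDn_sq hk u
  have e4 := jacobiDn_sq hk v
  -- The three addition formulas share a denominator; cancelling it leaves a polynomial identity
  -- modulo `e1`–`e4`.
  rw [jacobiSn_add hk, jacobiCn_add hk, jacobiDn_add hk, div_mul_eq_mul_div, div_mul_eq_mul_div,
    div_mul_eq_mul_div, ← add_div, div_left_inj' hD]
  generalize jacobiSn k u = S at *
  generalize jacobiCn k u = C at *
  generalize jacobiDn k u = D at *
  generalize jacobiSn k v = s at *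
  generalize jacobiCn k v = c at *
  generalize jacobiDn k v = d at *
  grind

/-! ### Tangent lines and asymptotes -/

theorem hyperbolaForm_fderiv (a₀ c₀ : ℝ) (p v : ℝ × ℝ) :
    fderiv ℝ (hyperbolaForm a₀ c₀) p v = 2 * p.1 * v.1 / a₀ - 2 * p.2 * v.2 / c₀ := by
  have h1 : HasFDerivAt (fun q : ℝ × ℝ => q.1) (ContinuousLinearMap.fst ℝ ℝ ℝ) p :=
    hasFDerivAt_fst
  have h2 : HasFDerivAt (fun q : ℝ × ℝ => q.2) (ContinuousLinearMap.snd ℝ ℝ ℝ) p :=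
    hasFDerivAt_snd
  have h : HasFDerivAt (hyperbolaForm a₀ c₀) _ p :=
    ((h1.pow 2).mul_const a₀⁻¹).sub ((h2.pow 2).mul_const c₀⁻¹)
  rw [h.fderiv]
  simp
  ring

/-- The line `A x + B y = C` with `A ≠ 0` and `a₀ A² - c₀ B² = C²` is a tangent of the hyperbola
`x² / a₀ - y² / c₀ = 1`, at a finite point if `C ≠ 0` and at infinity if `C = 0`. -/
theorem exists_tangent_line {a₀ c₀ A B C : ℝ} (ha : 0 < a₀) (hc : 0 < c₀) (hA : A ≠ 0)
    (h : a₀ * A ^ 2 - c₀ * B ^ 2 = C ^ 2) :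
    ∃ L : AffineSubspace ℝ (ℝ × ℝ), IsStraightLine L ∧
      (∀ p : ℝ × ℝ, A * p.1 + B * p.2 = C → p ∈ L) ∧
      (C ≠ 0 → IsTangentLine a₀ c₀ L) ∧ (C = 0 → IsAsymptote a₀ c₀ L) := by
  set L := AffineSubspace.mk' ((C / A, 0) : ℝ × ℝ) (Submodule.span ℝ {((-B, A) : ℝ × ℝ)}) with hL
  have hline : IsStraightLine L := by
    rw [IsStraightLine, hL, AffineSubspace.direction_mk']
    exact finrank_span_singleton fun h0 => hA (Prod.ext_iff.1 h0).2
  have hmem : ∀ p : ℝ × ℝ, p ∈ L ↔ A * p.1 + B * p.2 = C := by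
    intro p
    rw [hL, AffineSubspace.mem_mk', Submodule.mem_span_singleton]
    constructor
    · rintro ⟨t, ht⟩
      have h1 := (Prod.ext_iff.1 ht).1
      have h2 := (Prod.ext_iff.1 ht).2
      simp at h1 h2
      have h3 : p.1 = C / A - t * B := by linarith
      rw [h3, ← h2]
      field_simp
      ring
    · intro hp
      refine ⟨p.2 / A, Prod.ext ?_ ?_⟩
      · simp
        field_simp
        linarith
      · simp
        field_simp
  -- The tangent at `(x₀, y₀)` is `x₀ x / a₀ - y₀ y / c₀ = 1`; comparison with `(A / C) x + (B / C)
  -- y = 1` gives the contact point.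
  refine ⟨L, hline, fun p hp => (hmem p).2 hp, fun hC => ⟨hline, (a₀ * A / C, -(c₀ * B / C)),
    ?_, ?_, ?_⟩, fun hC => ?_⟩
  · simp only [hyperbola, hyperbolaForm, Set.mem_ofPred_eq]
    field_simp
    linarith
  · rw [hmem]
    field_simp
    linarith
  · intro v hv
    rw [hL, AffineSubspace.direction_mk', Submodule.mem_span_singleton] at hv
    obtain ⟨t, rfl⟩ := hv
    rw [hyperbolaForm_fderiv]
    simp
    field_simp
    ring
  · subst hC
    have hB : B ≠ 0 := by
      rintro rfl
      have : a₀ * A ^ 2 ≠ 0 := by positivity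
      exact this (by linarith)
    -- For `C = 0` the tangency condition is `a₀ A² = c₀ B²`; the sign of `A / B` then selects the
    -- asymptote.
    have hs : Real.sqrt (c₀ / a₀) = |A / B| := by
      rw [← Real.sqrt_sq_eq_abs]
      congr 1
      field_simp
      linarith
    have hset : (L : Set (ℝ × ℝ)) = {q | q.2 = -(A / B) * q.1} := by
      ext q
      rw [SetLike.mem_coe, hmem, Set.mem_ofPred_eq]
      constructor
      · intro hq
        field_simp
        linarith
      · intro hq
        rw [hq]
        field_simp
        ring
    rw [IsAsymptote, hs, hset]
    rcases abs_choice (A / B) with h' | h' <;> rw [h'] <;> simp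

/-- Matching `a + l = a₀` forces `l = a₀ - a`, and the sum condition then gives `b + l = -c₀`. -/
theorem hyperbola_eq_confocalConic {a b a₀ c₀ : ℝ} (ha : 0 < a₀) (hc : 0 < c₀)
    (h : a₀ + c₀ = a - b) :
    ∃ l : ℝ, -a < l ∧ l < -b ∧ hyperbola a₀ c₀ = confocalConic a b l := by
  refine ⟨a₀ - a, by linarith, by linarith, ?_⟩
  ext p
  rw [hyperbola, confocalConic, Set.mem_ofPred_eq, Set.mem_ofPred_eq, hyperbolaForm,
    show a + (a₀ - a) = a₀ by ring, show b + (a₀ - a) = -c₀ by linarith, div_neg, sub_eq_add_neg]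

/-! ### The common tangent lines of both coordinate systems -/

/-- The point whose coordinates are those of the confocal coordinate system, the first multiplied
by `P` and the second by `Q`. -/
noncomputable def scaledPoint (a b k P Q u v : ℝ) : ℝ × ℝ :=
  (Real.sqrt (a - b) * P * (k * jacobiSn k u / jacobiSn k v),
    Real.sqrt (a - b) * Q * (jacobiDn k u * jacobiCn k v / jacobiSn k v))

theorem exists_tangent_line_of_add {a b k P Q : ℝ} (hab : b < a) (hk0 : 0 < k ^ 2)
    (hk1 : k ^ 2 < 1) (hP : 0 < P) (hQ : 0 < Q) (ξ : ℝ) :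
    ∃ L : AffineSubspace ℝ (ℝ × ℝ), IsStraightLine L ∧
      (∀ u v : ℝ, jacobiSn k v ≠ 0 → u + v = ξ → scaledPoint a b k P Q u v ∈ L) ∧
      (jacobiCn k ξ ≠ 0 →
        IsTangentLine (k ^ 2 * (a - b) * P ^ 2) ((1 - k ^ 2) * (a - b) * Q ^ 2) L) ∧
      (jacobiCn k ξ = 0 →
        IsAsymptote (k ^ 2 * (a - b) * P ^ 2) ((1 - k ^ 2) * (a - b) * Q ^ 2) L) := by
  have hk : k ≠ 0 := by rintro rfl; simp at hk0
  have hab' : 0 < a - b := sub_pos.2 hab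
  have hk1' : 0 < 1 - k ^ 2 := sub_pos.2 hk1
  have hr := Real.sqrt_pos.2 hab'
  have hr2 := Real.sq_sqrt hab'.le
  have hd := jacobiDn_pos hk1 ξ
  -- The coefficients are read off the linear relation; `P` and `Q` cancel in the tangency
  -- condition.
  obtain ⟨L, hL, hmem, ht, has⟩ := exists_tangent_line (a₀ := k ^ 2 * (a - b) * P ^ 2)
    (c₀ := (1 - k ^ 2) * (a - b) * Q ^ 2) (A := jacobiDn k ξ / (k * P))
    (B := -(jacobiSn k ξ / Q)) (C := -(Real.sqrt (a - b) * jacobiCn k ξ))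
    (by positivity) (by positivity) (by positivity) (by
      have e1 := jacobiSn_sq_add_jacobiCn_sq k ξ
      have e2 := jacobiDn_sq hk1 ξ
      rw [neg_sq, neg_sq, mul_pow (Real.sqrt _), hr2]
      field_simp
      rw [e2]
      linear_combination (-1 : ℝ) * e1)
  refine ⟨L, hL, fun u v hv huv => hmem _ ?_, fun h => ht ?_, fun h => has (by simp [h])⟩
  · have e := jacobi_linear_relation hk1 u v
    rw [huv] at e
    simp only [scaledPoint]
    field_simp
    linear_combination (-1 : ℝ) * e
  · exact neg_ne_zero.2 (mul_ne_zero hr.ne' h)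

/-- The functions depend on `k` only through `k²`, `sn` is odd and `dn` even, so `scaledPoint` is
unchanged under `(k, u) ↦ (-k, -u)`, which turns `v - u` into a sum. -/
theorem exists_tangent_line_of_sub {a b k P Q : ℝ} (hab : b < a) (hk0 : 0 < k ^ 2)
    (hk1 : k ^ 2 < 1) (hP : 0 < P) (hQ : 0 < Q) (η : ℝ) :
    ∃ L : AffineSubspace ℝ (ℝ × ℝ), IsStraightLine L ∧
      (∀ u v : ℝ, jacobiSn k v ≠ 0 → v - u = η → scaledPoint a b k P Q u v ∈ L) ∧
      (jacobiCn k η ≠ 0 →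
        IsTangentLine (k ^ 2 * (a - b) * P ^ 2) ((1 - k ^ 2) * (a - b) * Q ^ 2) L) ∧
      (jacobiCn k η = 0 →
        IsAsymptote (k ^ 2 * (a - b) * P ^ 2) ((1 - k ^ 2) * (a - b) * Q ^ 2) L) := by
  have hk0' : 0 < (-k) ^ 2 := by rwa [neg_sq]
  have hk1' : (-k) ^ 2 < 1 := by rwa [neg_sq]
  have hF : ellipticF (-k) = ellipticF k := by funext φ; simp [ellipticF]
  have hAm : jacobiAm (-k) = jacobiAm k := by funext u; simp [jacobiAm, hF]
  have hSn : jacobiSn (-k) = jacobiSn k := by funext u; simp [jacobiSn, hAm]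
  have hCn : jacobiCn (-k) = jacobiCn k := by funext u; simp [jacobiCn, hAm]
  have hDn : jacobiDn (-k) = jacobiDn k := by funext u; simp [jacobiDn, hSn]
  have h := exists_tangent_line_of_add hab hk0' hk1' hP hQ η
  simp only [neg_sq, hCn] at h
  obtain ⟨L, hL, hmem, ht⟩ := h
  refine ⟨L, hL, fun u v hv huv => ?_, ht⟩
  have := hmem (-u) v (by rwa [hSn]) (by linarith)
  simpa [scaledPoint, hSn, hCn, hDn, jacobiSn_neg hk1, jacobiDn_neg hk1] using this

/-! ### Both parametrizations as rescaled points -/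

theorem continuousPoint_eq_scaledPoint {a b : ℝ} (hab : b < a) (k u v : ℝ) :
    continuousPoint a b k u v = scaledPoint a b k 1 1 u v := by
  have hr := (Real.sqrt_pos.2 (sub_pos.2 hab)).ne'
  simp only [continuousPoint, confocalPoint, scaledPoint]
  ext <;> simp only <;> field_simp

/-- Only the squares of the amplitudes enter the coordinates; `cn (δ/2) > 0` ensures that `alphaHat`
squares to its radicand. -/
theorem discretePoint_eq_scaledPoint {a b k δ : ℝ} (hab : b < a) (hk : k ^ 2 < 1)
    (hδ : 0 < jacobiCn k (δ / 2)) (c₁ c₂ n₁ n₂ : ℝ) :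
    discretePoint a b k δ c₁ c₂ n₁ n₂ =
      scaledPoint a b k (jacobiCn k (δ / 2) / jacobiDn k (δ / 2)) (1 / jacobiDn k (δ / 2))
        (δ * n₁ + c₁) (δ * n₂ + c₂) := by
  have hab' := sub_pos.2 hab
  have hr := (Real.sqrt_pos.2 hab').ne'
  have hr2 := Real.sq_sqrt hab'.le
  have hd := jacobiDn_pos hk (δ / 2)
  have hα : alphaHat a b k δ ^ 2 = (a - b) * (jacobiCn k (δ / 2) / jacobiDn k (δ / 2)) :=
    Real.sq_sqrt (by positivity)
  have hβ : betaHat a b k δ ^ 2 = (a - b) * (1 / jacobiDn k (δ / 2)) := by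
    rw [betaHat, Real.sq_sqrt (by positivity)]
    ring
  rw [← hr2] at hα hβ
  simp only [discretePoint, confocalPoint, scaledPoint]
  ext
  · rw [div_eq_iff hr]
    linear_combination (k * jacobiSn k (δ * n₁ + c₁) / jacobiSn k (δ * n₂ + c₂)) * hα
  · rw [div_eq_iff hr]
    linear_combination (jacobiDn k (δ * n₁ + c₁) * jacobiCn k (δ * n₂ + c₂) /
      jacobiSn k (δ * n₂ + c₂)) * hβ

theorem mainTheorem10 (a b k : ℝ) (hab : b < a) (hk0 : 0 < k ^ 2) (hk1 : k ^ 2 < 1) :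
    -- the continuous coordinate system
    (∀ a₀ c₀ : ℝ, a₀ = k ^ 2 * (a - b) → c₀ = (1 - k ^ 2) * (a - b) →
      (∀ ξ : ℝ, ∃ L : AffineSubspace ℝ (ℝ × ℝ), IsStraightLine L ∧
        (∀ s₁ s₂ : ℝ, jacobiSn k s₂ ≠ 0 → s₁ + s₂ = ξ → continuousPoint a b k s₁ s₂ ∈ L) ∧
        (jacobiCn k ξ ≠ 0 → IsTangentLine a₀ c₀ L) ∧
        (jacobiCn k ξ = 0 → IsAsymptote a₀ c₀ L)) ∧
      (∀ η : ℝ, ∃ L : AffineSubspace ℝ (ℝ × ℝ), IsStraightLine L ∧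
        (∀ s₁ s₂ : ℝ, jacobiSn k s₂ ≠ 0 → s₂ - s₁ = η → continuousPoint a b k s₁ s₂ ∈ L) ∧
        (jacobiCn k η ≠ 0 → IsTangentLine a₀ c₀ L) ∧
        (jacobiCn k η = 0 → IsAsymptote a₀ c₀ L)) ∧
      0 < a₀ ∧ 0 < c₀ ∧ a₀ + c₀ = a - b ∧
      ∃ l : ℝ, -a < l ∧ l < -b ∧ hyperbola a₀ c₀ = confocalConic a b l) ∧
    -- the discrete coordinate system
    (∀ δ c₁ c₂ : ℝ, 0 < jacobiCn k (δ / 2) →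
      (∀ ξ ∈ halfIntegers, ∃ L : AffineSubspace ℝ (ℝ × ℝ), IsStraightLine L ∧
        (∀ n₁ ∈ halfIntegers, ∀ n₂ ∈ halfIntegers, jacobiSn k (δ * n₂ + c₂) ≠ 0 →
          n₁ + n₂ = ξ → discretePoint a b k δ c₁ c₂ n₁ n₂ ∈ L) ∧
        (jacobiCn k (δ * ξ + c₁ + c₂) ≠ 0 → IsTangentLine (aHat a b k δ) (cHat a b k δ) L) ∧
        (jacobiCn k (δ * ξ + c₁ + c₂) = 0 → IsAsymptote (aHat a b k δ) (cHat a b k δ) L)) ∧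
      (∀ η ∈ halfIntegers, ∃ L : AffineSubspace ℝ (ℝ × ℝ), IsStraightLine L ∧
        (∀ n₁ ∈ halfIntegers, ∀ n₂ ∈ halfIntegers, jacobiSn k (δ * n₂ + c₂) ≠ 0 →
          n₂ - n₁ = η → discretePoint a b k δ c₁ c₂ n₁ n₂ ∈ L) ∧
        (jacobiCn k (δ * η + c₂ - c₁) ≠ 0 → IsTangentLine (aHat a b k δ) (cHat a b k δ) L) ∧
        (jacobiCn k (δ * η + c₂ - c₁) = 0 → IsAsymptote (aHat a b k δ) (cHat a b k δ) L)) ∧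
      0 < aHat a b k δ ∧ 0 < cHat a b k δ ∧ aHat a b k δ + cHat a b k δ = a - b ∧
      ∃ l : ℝ, -a < l ∧ l < -b ∧
        hyperbola (aHat a b k δ) (cHat a b k δ) = confocalConic a b l) := by
  have hab' : 0 < a - b := sub_pos.2 hab
  have hk1' : 0 < 1 - k ^ 2 := sub_pos.2 hk1
  constructor
  · rintro a₀ c₀ rfl rfl
    have ha : 0 < k ^ 2 * (a - b) := by positivity
    have hc : 0 < (1 - k ^ 2) * (a - b) := by positivity
    have hsum : k ^ 2 * (a - b) + (1 - k ^ 2) * (a - b) = a - b := by ring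
    refine ⟨fun ξ => ?_, fun η => ?_, ha, hc, hsum, hyperbola_eq_confocalConic ha hc hsum⟩
    · simpa [continuousPoint_eq_scaledPoint hab] using
        exists_tangent_line_of_add hab hk0 hk1 one_pos one_pos ξ
    · simpa [continuousPoint_eq_scaledPoint hab] using
        exists_tangent_line_of_sub hab hk0 hk1 one_pos one_pos η
  · intro δ c₁ c₂ hδ
    have hd := jacobiDn_pos hk1 (δ / 2)
    have hP : 0 < jacobiCn k (δ / 2) / jacobiDn k (δ / 2) := by positivity
    have hQ : 0 < 1 / jacobiDn k (δ / 2) := by positivity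
    have ha' : aHat a b k δ = k ^ 2 * (a - b) * (jacobiCn k (δ / 2) / jacobiDn k (δ / 2)) ^ 2 := by
      rw [aHat]; ring
    have hc' : cHat a b k δ = (1 - k ^ 2) * (a - b) * (1 / jacobiDn k (δ / 2)) ^ 2 := by
      rw [cHat]; ring
    have ha : 0 < aHat a b k δ := by rw [ha']; positivity
    have hc : 0 < cHat a b k δ := by rw [hc']; positivity
    have hsum : aHat a b k δ + cHat a b k δ = a - b := by
      rw [aHat, cHat]
      field_simp
      -- Confocality amounts to `k² cn² + (1 - k²) = dn²` at `δ/2`.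
      linear_combination k ^ 2 * jacobiSn_sq_add_jacobiCn_sq k (δ / 2) - jacobiDn_sq hk1 (δ / 2)
    refine ⟨fun ξ _ => ?_, fun η _ => ?_, ha, hc, hsum, hyperbola_eq_confocalConic ha hc hsum⟩
    · obtain ⟨L, hL, hmem, ht⟩ :=
        exists_tangent_line_of_add hab hk0 hk1 hP hQ (δ * ξ + c₁ + c₂)
      rw [← ha', ← hc'] at ht
      refine ⟨L, hL, fun n₁ _ n₂ _ hn h => ?_, ht⟩
      rw [discretePoint_eq_scaledPoint hab hk1 hδ]
      exact hmem _ _ hn (by rw [← h]; ring)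
    · obtain ⟨L, hL, hmem, ht⟩ :=
        exists_tangent_line_of_sub hab hk0 hk1 hP hQ (δ * η + c₂ - c₁)
      rw [← ha', ← hc'] at ht
      refine ⟨L, hL, fun n₁ _ n₂ _ hn h => ?_, ht⟩
      rw [discretePoint_eq_scaledPoint hab hk1 hδ]
      exact hmem _ _ hn (by rw [← h]; ring)
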